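/- **Setting.** There are $T\ge 16$ rounds and a per-round budget $\rho\in(0,1]$. In round $t$ the bidder sees a valuation $v_t\in V$ and a dual variable $\lambda_t\in[0,1/\rho]$, places a bid $b$, and then sees the highest competing bid $m_t\in\mathbb R$. With $f_t(b)=(v_t-b)\mathbf 1\{b\ge m_t\}$ and $c_t(b)=b\,\mathbf 1\{b\ge m_t\}$, the primal utility of $b$ is $f_t(b)-\lambda_t c_t(b)$. Here $V,B\subseteq[0,1]$ are arbitrary sets of valuations and bids, and $\Pi_L$ is the set of maps $\pi:V\to B$ with $|\pi(v)-\pi(v')|\le|v-v'|$ for all $v,v'\in V$. **Discretization.** Let $M=\lfloor\log_2\sqrt T\rfloor$, $\epsilon_m=2^{-m}$, $V_{\epsilon}=\{0,\epsilon,2\epsilon,\dots,1\}$, $B_{1/T}=\{0,1/T,\dots,1\}$, and let $\lfloor x\rfloor_y$ be the largest nonnegative multiple of $y$ that is at most $x$. Let $\hat\Pi_{\epsilon_m}$ be the set of maps $\hat\pi:V_{\epsilon_m}\to B_{1/T}$ with $|\hat\pi(v)-\hat\pi(v')|\le2|v-v'|$ for all $v,v'\in V_{\epsilon_m}$. For a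 real-valued function $\pi$ on $V_{\epsilon_m}$, the thresholded policy is $\gamma(\pi)(v,\lambda)=\min\{\pi(\lfloor v\rfloor_{\epsilon_m})+2\epsilon_m,\ v/(1+\lambda)\}$, and $r_t(\pi)=\mathbf 1\{b\ge m_t\}(v_t-(1+\lambda_t)b)$ with $b=\gamma(\pi)(v_t,\lambda_t)$. **Tree.** Nodes are identified with the sequences of edges leading to them from the root $\varnothing$ (level $0$); edges are policies, $\sigma_h$ is the last policy on the path to $h\neq\varnothing$, and the level of $h$ is the $m$ such that $\sigma_h$ is a function on $V_{\epsilon_m}$. Nodes of level $M$ are terminal. A node $h$ of level $m<M$ has the edge set $A(h)=C(h)\cup\{\zeta_h\}$, where $C(\varnothing)=\hat\Pi_{\epsilon_1}$; for $m\ge1$, $C(h)$ is the set of $\hat\pi\in\hat\Pi_{\epsilon_{m+1}}$ that agree with $\sigma_h$ on $V_{\epsilon_m}$; and $\zeta_h$ is the function on $V_{\epsilon_M}$ (so that its edge leads to a terminal node) given for $m\ge1$ by $\zeta_h(v)=\sigma_h(\lfloor v\rfloor_{\epsilon_m})+\lfloor2(v-\lfloor v\rfloor_{\epsilon_m})\rfloor_{1/T}$,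 while $\zeta_\varnothing:V_{\epsilon_M}\to[0,\infty)$ is an arbitrary fixed function. Let $\Pi_Z$ be the set of the policies $\sigma_z$ over all terminal nodes $z$. **Algorithm.** Let $\Delta_m=4(1+1/\rho)\epsilon_m$ and $r_{0,h}[\pi]=0$. In round $t=1,\dots,T$, for each nonterminal $h$ of level $m$ and $\pi\in A(h)$, put $$\eta_{t,h}=\min\Big\{\tfrac14,\sqrt{\tfrac{\log|A(h)|}{t\,\Delta_m}}\Big\},\qquad q_{t,h}[\pi]=\frac{\exp(\eta_{t,h}\,r_{t-1,h}[\pi])}{\sum_{\pi'\in A(h)}\exp(\eta_{t,h}\,r_{t-1,h}[\pi'])}.$$ For $\pi\in\Pi_Z$ put $p_{t,h}[\pi]=\mathbf 1\{\pi=\sigma_h\}$ if $h$ is terminal and $p_{t,h}[\pi]=\sum_{\pi'\in A(h)}q_{t,h}[\pi']\,p_{t,h\cdot\pi'}[\pi]$ otherwise. Draw $\pi_t\sim p_{t,\varnothing}$ and bid $\gamma(\pi_t)(v_t,\lambda_t)\in[0,1]$. Finally set $r_{t,h}[\pi]=r_{t-1,h}[\pi]+\sum_{\pi'\in\Pi_Z}p_{t,h\cdot\pi}[\pi']\,r_t(\pi')$.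 **Theorem.** There is an absolute constant $C$ such that for all $T\ge16$, $\rho\in(0,1]$, $V,B\subseteq[0,1]$, all $\zeta_\varnothing$, and all sequences $v_t\in V$, $m_t\in\mathbb R$, $\lambda_t\in[0,1/\rho]$, $$\sup_{\pi^*\in\Pi_L}\sum_{t=1}^T\Big(f_t(\pi^*(v_t))-\lambda_t c_t(\pi^*(v_t))-\mathbb E_{\pi\sim p_{t,\varnothing}}[r_t(\pi)]\Big)\ \le\ C\,\frac1\rho\,\sqrt T\,\log^2T .$$ -/

import Mathlib

open Finset

noncomputable section

namespace FirstPrice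

/-! ### Auction primitives -/

/-- Reward of bidding `b` at valuation `v` when the highest competing bid is `mb`:
the item is won iff `mb ≤ b`, and the winner pays `b`. -/
def reward (v mb b : ℝ) : ℝ := if mb ≤ b then v - b else 0

/-- Cost (budget consumption) of bidding `b` when the highest competing bid is `mb`. -/
def cost (mb b : ℝ) : ℝ := if mb ≤ b then b else 0

/-- The `1`-Lipschitz bidding policies from the valuation set `V` to the bid set `B`. -/
def lipschitzPolicies (V B : Set ℝ) : Set (V → B) :=
  {π | ∀ v v' : V, |(π v : ℝ) - (π v' : ℝ)| ≤ |(v : ℝ) - (v' : ℝ)|}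

/-! ### Discretization -/

/-- The discretization step `ε_m = 2^{-m}`. -/
def eps (m : ℕ) : ℝ := 1 / 2 ^ m

/-- For `x ≥ 0` and `y > 0`: the largest nonnegative multiple of `y` that is at most `x`. -/
def disc (x y : ℝ) : ℝ := ⌊x / y⌋₊ * y

/-- The `i`-th point `i * ε_m` of the value grid `V_{ε_m} = {0, ε_m, 2 ε_m, …, 1}`; the grid is
indexed by `Fin (2 ^ m + 1)`. -/
def gridPt (m : ℕ) (i : Fin (2 ^ m + 1)) : ℝ := (i : ℕ) * eps m

/-- The index of the grid point `disc v ε_m`, for `v ∈ [0, 1]` (see `gridPt_gridFloor`). -/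
def gridFloor (m : ℕ) (v : ℝ) : Fin (2 ^ m + 1) :=
  ⟨min ⌊v / eps m⌋₊ (2 ^ m), Nat.lt_succ_of_le (min_le_right _ _)⟩

theorem gridPt_gridFloor (m : ℕ) {v : ℝ} (hv : v ≤ 1) :
    gridPt m (gridFloor m v) = disc v (eps m) := by
  have h : ⌊v / eps m⌋₊ ≤ 2 ^ m := by
    apply Nat.floor_le_of_le
    have h2 : (0 : ℝ) < 2 ^ m := by positivity
    simp only [eps, div_div_eq_mul_div, div_one]
    push_cast
    nlinarith
  simp [gridPt, gridFloor, disc, min_eq_left h]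

/-- Index in `V_{ε_{m+1}}` of the `i`-th point of `V_{ε_m}`, seen as a point of the finer grid. -/
def refineIdx (m : ℕ) (i : Fin (2 ^ m + 1)) : Fin (2 ^ (m + 1) + 1) :=
  ⟨2 * (i : ℕ), by have := i.isLt; rw [pow_succ]; omega⟩

theorem gridPt_refineIdx (m : ℕ) (i : Fin (2 ^ m + 1)) :
    gridPt (m + 1) (refineIdx m i) = gridPt m i := by
  simp only [gridPt, refineIdx, eps, pow_succ]
  push_cast
  field_simp

/-- The bid grid `B_{1/T} = {0, 1/T, …, 1}`. -/
def bidGrid (T : ℕ) : Finset ℝ := (range (T + 1)).image fun j : ℕ => (j : ℝ) / T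

/-- Real-valued functions on the value grid `V_{ε_m}`. -/
abbrev GridFun (m : ℕ) : Type := Fin (2 ^ m + 1) → ℝ

/-- The discretized policies at step `ε_m`: the `2`-Lipschitz maps `V_{ε_m} → B_{1/T}`. -/
def discPolicies (T m : ℕ) : Finset (GridFun m) :=
  {π ∈ Fintype.piFinset fun _ : Fin (2 ^ m + 1) => bidGrid T |
    ∀ i j, |π i - π j| ≤ 2 * |gridPt m i - gridPt m j|}

/-- A policy on one of the value grids, together with the level of that grid. -/
abbrev Edge : Type := (m : ℕ) × GridFun m

/-- The thresholded policy of `π`, evaluated at valuation `v` and dual variable `lam`. -/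
def thresholded (π : Edge) (v lam : ℝ) : ℝ :=
  min (π.2 (gridFloor π.1 v) + 2 * eps π.1) (v / (1 + lam))

/-- The instantaneous reward `r(π, lam, v, mb)` of the thresholded policy of `π`. -/
def instReward (π : Edge) (lam v mb : ℝ) : ℝ :=
  if mb ≤ thresholded π v lam then v - (1 + lam) * thresholded π v lam else 0

/-! ### The hierarchical tree -/

/-- A node is the list of edges on the path from the root to it, the last edge first. -/
abbrev Node : Type := List Edge

/-- The level of a node: the level of the last policy on its path, and `0` at the root. -/
def level : Node → ℕ
  | [] => 0
  | e :: _ => e.1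

/-- `C(h)`: the discretized policies one level finer that agree with the last policy of `h` on the
grid of the latter; at the root, all discretized policies of the first level. -/
def refinements (T : ℕ) : Node → Finset Edge
  | [] => (discPolicies T 1).image fun π => ⟨1, π⟩
  | ⟨m, σ⟩ :: _ =>
      {π ∈ discPolicies T (m + 1) | ∀ i, π (refineIdx m i) = σ i}.image fun π => ⟨m + 1, π⟩

/-- The jump policy of `h`, on the finest grid `V_{ε_M}`: at a node of level `m ≥ 1` with last policy
`σ` it is `v ↦ σ(disc v ε_m) + disc (2 * (v - disc v ε_m)) (1/T)`; at the root it is the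
parameter `ζ₀`. -/
def jump (T M : ℕ) (ζ₀ : GridFun M) : Node → GridFun M
  | [] => ζ₀
  | ⟨m, σ⟩ :: _ => fun i =>
      σ (gridFloor m (gridPt M i)) +
        disc (2 * (gridPt M i - disc (gridPt M i) (eps m))) (1 / T)

/-- `A(h)`: the edges available at `h`; there are none at the terminal nodes, those of level `M`. -/
def edges (T M : ℕ) (ζ₀ : GridFun M) (h : Node) : Finset Edge :=
  if level h < M then refinements T h ∪ {⟨M, jump T M ζ₀ h⟩} else ∅

theorem level_lt_of_mem_edges {T M : ℕ} {ζ₀ : GridFun M} {h : Node} {e : Edge}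
    (he : e ∈ edges T M ζ₀ h) : level h < e.1 ∧ level h < M := by
  unfold edges at he
  split_ifs at he with hl
  · refine ⟨?_, hl⟩
    rcases Finset.mem_union.1 he with he | he
    · rcases h with _ | ⟨⟨m, σ⟩, h⟩
      · obtain ⟨π, -, rfl⟩ := Finset.mem_image.1 he
        simp [level]
      · obtain ⟨π, -, rfl⟩ := Finset.mem_image.1 he
        simp [level]
    · rw [Finset.mem_singleton.1 he]
      exact hl
  · simp at he

/-- The set of last policies `σ_z` of the terminal nodes `z` below `h`. -/
def terminalBelow (T M : ℕ) (ζ₀ : GridFun M) (h : Node) : Finset Edge :=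
  if level h < M then
    (edges T M ζ₀ h).attach.biUnion fun e => terminalBelow T M ζ₀ (e.1 :: h)
  else h.head?.toFinset
termination_by M - level h
decreasing_by
  have := level_lt_of_mem_edges e.2
  simp only [level] at *
  omega

/-- The policies available to the bidder: `σ_z` for all terminal nodes `z` of the tree. -/
def terminalPolicies (T M : ℕ) (ζ₀ : GridFun M) : Finset Edge := terminalBelow T M ζ₀ []

/-- The mixture `p_h` over terminal policies induced at `h` by the local distributions `q`:
`p_h[π] = ∑_{e ∈ A(h)} q_h[e] * p_{h·e}[π]` at nonterminal nodes, and the point mass at the last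
policy of `h` at terminal nodes. -/
def mixture (T M : ℕ) (ζ₀ : GridFun M) (q : Node → Edge → ℝ) (h : Node) (π : Edge) : ℝ :=
  if level h < M then
    ∑ e ∈ (edges T M ζ₀ h).attach, q h e.1 * mixture T M ζ₀ q (e.1 :: h) π
  else if h.head? = some π then 1 else 0
termination_by M - level h
decreasing_by
  have := level_lt_of_mem_edges e.2
  simp only [level] at *
  omega

/-- Expectation of the instantaneous reward when the policy is drawn from the mixture at `h`. -/
def mixtureReward (T M : ℕ) (ζ₀ : GridFun M) (q : Node → Edge → ℝ) (h : Node)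
    (lam v mb : ℝ) : ℝ :=
  ∑ π ∈ terminalPolicies T M ζ₀, mixture T M ζ₀ q h π * instReward π lam v mb

/-! ### The hierarchical chaining algorithm -/

/-- `Δ_m = 4 (1 + 1/ρ) ε_m`. -/
def gap (ρ : ℝ) (m : ℕ) : ℝ := 4 * (1 + 1 / ρ) * eps m

/-- The learning rate of node `h` in round `t ≥ 1`. -/
def learningRate (T M : ℕ) (ζ₀ : GridFun M) (ρ : ℝ) (t : ℕ) (h : Node) : ℝ :=
  min (1 / 4) (√(Real.log (#(edges T M ζ₀ h)) / (t * gap ρ (level h))))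

/-- The exponential-weights distribution over the edges of `h` in round `t`, when `R h e` is the
cumulative reward of edge `e` at node `h` over the previous rounds. -/
def expWeights (T M : ℕ) (ζ₀ : GridFun M) (ρ : ℝ) (t : ℕ) (R : Node → Edge → ℝ)
    (h : Node) (e : Edge) : ℝ :=
  Real.exp (learningRate T M ζ₀ ρ t h * R h e) /
    ∑ e' ∈ edges T M ζ₀ h, Real.exp (learningRate T M ζ₀ ρ t h * R h e')

/-- The cumulative rewards `r_{t,h}[e]` kept by the algorithm, when `v t`, `mb t`, `lam t` are the
valuation, the highest competing bid and the dual variable of round `t = 1, 2, …`. -/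
def cumReward (T M : ℕ) (ζ₀ : GridFun M) (ρ : ℝ) (v mb lam : ℕ → ℝ) :
    ℕ → Node → Edge → ℝ
  | 0 => fun _ _ => 0
  | t + 1 => fun h e =>
      cumReward T M ζ₀ ρ v mb lam t h e +
        mixtureReward T M ζ₀
          (expWeights T M ζ₀ ρ (t + 1) (cumReward T M ζ₀ ρ v mb lam t))
          (e :: h) (lam (t + 1)) (v (t + 1)) (mb (t + 1))

/-- The expected reward of the algorithm in round `t ≥ 1`: the policy is drawn from the mixture at
the root, and its thresholded version is played. -/
def algReward (T M : ℕ) (ζ₀ : GridFun M) (ρ : ℝ) (v mb lam : ℕ → ℝ) (t : ℕ) : ℝ :=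
  mixtureReward T M ζ₀
    (expWeights T M ζ₀ ρ t (cumReward T M ζ₀ ρ v mb lam (t - 1)))
    [] (lam t) (v t) (mb t)

/-- The number of levels `M = ⌊log₂ √T⌋`. -/
def numLevels (T : ℕ) : ℕ := ⌊Real.logb 2 (√(T : ℝ))⌋₊

/-- The cumulative primal regret over `T` rounds of the algorithm with horizon `T` and per-round
budget `ρ`, against the best `1`-Lipschitz policy. -/
def primalRegret (T : ℕ) (ζ₀ : GridFun (numLevels T)) (ρ : ℝ) (V B : Set ℝ)
    (v : ℕ → V) (mb lam : ℕ → ℝ) : EReal :=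
  ⨆ π ∈ lipschitzPolicies V B,
    ((∑ t ∈ Icc 1 T,
        (reward (v t) (mb t) (π (v t)) - lam t * cost (mb t) (π (v t))
          - algReward T (numLevels T) ζ₀ ρ (fun s => (v s : ℝ)) mb lam t) : ℝ) : EReal)

end FirstPrice

end

/-! The regret is split along a single root-to-leaf path of the tree. A Lipschitz comparator,
extended to all of `ℝ` and rounded down to multiples of `1/T`, restricts to every grid `V_{ε_m}`;
these restrictions are consistent refinements, so they form a path that never uses a jump edge. Its
leaf is as good as the comparator up to `O(ε_M / ρ)` per round (`utility_le_instReward`): the added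
`2 ε_M` makes the bid at least the comparator's bid whenever the comparator has positive utility,
and the cap `v / (1 + λ)` keeps rewards nonnegative. The gap between leaf and root then telescopes
into the regrets of the nodes on the path, each against one of its own edges.

At a node the algorithm is exponential weights on the rewards of the subtrees. For these to have
small regret at fine levels, their range is not enough. By monotonicity of winning, overbidding by
`c` costs at most `(1 + λ) c`, while underbidding can lose the item altogether. The jump policy bids
at least as high as every leaf below the node and at most `4 ε_m` higher, so it is within `Δ_m` of
all edges in every round (`mixtureReward_le_jump`). With such an expert the second-order term of
exponential weights is at most `Δ_m` plus the regret against that expert, which a rate at most `1/4`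
absorbs (`softmax_regret_le`). The node's regret is `O(log |A| + √(T Δ_m log |A|))`.

Since `log |A|` grows like `2^m log T` and `Δ_m` decays like `2^{-m}`, the square roots are of the
same order at every level, and there are at most `log T` levels; the terms `log |A|` sum
geometrically to `O(√T log T)`. -/

namespace FirstPrice

/-! ### Exponential weights with a nearly optimal expert -/

/-- The exponential-weights distribution on `A` with learning rate `η` and cumulative rewards `R`. -/
noncomputable def softmax {ι : Type*} (A : Finset ι) (η : ℝ) (R : ι → ℝ) (e : ι) : ℝ :=
  Real.exp (η * R e) / ∑ e' ∈ A, Real.exp (η * R e')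

variable {ι : Type*} {A : Finset ι}

theorem sum_exp_pos (hA : A.Nonempty) (f : ι → ℝ) : 0 < ∑ e ∈ A, Real.exp (f e) :=
  Finset.sum_pos (fun _ _ => Real.exp_pos _) hA

theorem softmax_pos (hA : A.Nonempty) (η : ℝ) (R : ι → ℝ) (e : ι) : 0 < softmax A η R e :=
  div_pos (Real.exp_pos _) (sum_exp_pos hA _)

theorem sum_softmax (hA : A.Nonempty) (η : ℝ) (R : ι → ℝ) : ∑ e ∈ A, softmax A η R e = 1 := by
  unfold softmax
  rw [← Finset.sum_div, div_self (sum_exp_pos hA _).ne']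

/-- Follows from `exp (-x) ≥ 1 - x + x²/2` and `(1 + x + x²/2)(1 - x + x²/2) = 1 + x⁴/4 ≥ 1`. -/
theorem exp_le_quadratic_of_nonpos {x : ℝ} (hx : x ≤ 0) : Real.exp x ≤ 1 + x + x ^ 2 / 2 := by
  have h := Real.quadratic_le_exp_of_nonneg (x := -x) (by linarith)
  have hmul : Real.exp x * Real.exp (-x) = 1 := by rw [← Real.exp_add]; simp
  have hpos := Real.exp_pos x
  by_contra! hlt
  nlinarith [sq_nonneg (x ^ 2), sq_nonneg (1 + x), mul_nonneg (sub_nonneg.2 h) hpos.le]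

/-- Centering at an upper bound `b` of the rewards makes the exponents nonpositive, where the
quadratic bound on `exp` has the sharp constant `1/2`. The second-order term is thus measured from
`b`, which may vary with the round. -/
theorem log_sum_mul_exp_le {q r : ι → ℝ} (hA : A.Nonempty) (hq : ∀ e ∈ A, 0 < q e)
    (hs : ∑ e ∈ A, q e = 1) {η b : ℝ} (hη : 0 < η) (hr : ∀ e ∈ A, r e ≤ b) :
    Real.log (∑ e ∈ A, q e * Real.exp (η * r e)) ≤
      η * (∑ e ∈ A, q e * r e + η / 2 * ∑ e ∈ A, q e * (b - r e) ^ 2) := by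
  have hpos : 0 < ∑ e ∈ A, q e * Real.exp (η * r e) :=
    Finset.sum_pos (fun e he => mul_pos (hq e he) (Real.exp_pos _)) hA
  rw [Real.log_le_iff_le_exp hpos]
  set y := η * (∑ e ∈ A, q e * r e + η / 2 * ∑ e ∈ A, q e * (b - r e) ^ 2) with hy
  have hsum : ∑ e ∈ A, q e * (1 + η * (r e - b) + (η * (r e - b)) ^ 2 / 2) = 1 + (y - η * b) := by
    have : ∀ e ∈ A, q e * (1 + η * (r e - b) + (η * (r e - b)) ^ 2 / 2) =
        (1 - η * b) * q e + η * (q e * r e) + η * (η / 2) * (q e * (b - r e) ^ 2) := by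
      intro e _; ring
    rw [Finset.sum_congr rfl this, Finset.sum_add_distrib, Finset.sum_add_distrib,
      ← Finset.mul_sum, ← Finset.mul_sum, ← Finset.mul_sum, hs, hy]
    ring
  calc ∑ e ∈ A, q e * Real.exp (η * r e)
      ≤ ∑ e ∈ A, Real.exp (η * b) *
          (q e * (1 + η * (r e - b) + (η * (r e - b)) ^ 2 / 2)) := by
        refine Finset.sum_le_sum fun e he => ?_
        have h1 : Real.exp (η * r e) = Real.exp (η * b) * Real.exp (η * (r e - b)) := by
          rw [← Real.exp_add]; ring_nf
        have h2 := exp_le_quadratic_of_nonpos (x := η * (r e - b))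
          (mul_nonpos_of_nonneg_of_nonpos hη.le (by linarith [hr e he]))
        rw [h1, mul_left_comm]
        have := (hq e he).le
        gcongr
    _ = Real.exp (η * b) * (1 + (y - η * b)) := by rw [← Finset.mul_sum, hsum]
    _ ≤ Real.exp (η * b) * Real.exp (y - η * b) := by
        gcongr
        linarith [Real.add_one_le_exp (y - η * b)]
    _ = Real.exp y := by rw [← Real.exp_add]; ring_nf

/-- The normalized log-partition function is nondecreasing in the learning rate. -/
theorem log_mean_exp_div_mono (hA : A.Nonempty) (R : ι → ℝ) {η η' : ℝ} (hη' : 0 < η')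
    (h : η' ≤ η) :
    Real.log ((∑ e ∈ A, Real.exp (η' * R e)) / #A) / η' ≤
      Real.log ((∑ e ∈ A, Real.exp (η * R e)) / #A) / η := by
  have hη : 0 < η := hη'.trans_le h
  have hN : (0 : ℝ) < #A := by exact_mod_cast hA.card_pos
  -- Power mean inequality with exponent `η / η' ≥ 1`.
  have key := Real.rpow_arith_mean_le_arith_mean_rpow A (fun _ => (1 : ℝ) / #A)
    (fun e => Real.exp (η' * R e)) (fun _ _ => by positivity)
    (by rw [Finset.sum_const, nsmul_eq_mul]; field_simp) (fun _ _ => (Real.exp_pos _).le)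
    (p := η / η') ((one_le_div hη').2 h)
  have e1 : ∀ e, Real.exp (η' * R e) ^ (η / η') = Real.exp (η * R e) := by
    intro e
    rw [← Real.exp_mul]
    congr 1
    field_simp
  simp only [e1, ← Finset.sum_div, one_div, inv_mul_eq_div] at key
  have hp' : 0 < (∑ e ∈ A, Real.exp (η' * R e)) / #A := div_pos (sum_exp_pos hA _) hN
  have hlog := Real.log_le_log (Real.rpow_pos_of_pos hp' _) key
  rw [Real.log_rpow hp'] at hlog
  rw [div_le_div_iff₀ hη' hη]
  rw [div_mul_eq_mul_div, div_le_iff₀ hη'] at hlog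
  linarith

/-- The potential argument for exponential weights with nonincreasing learning rates. -/
theorem log_mean_exp_le_sum (hA : A.Nonempty) (r : ℕ → ι → ℝ) (b η : ℕ → ℝ)
    (hη : ∀ t, 0 < η t) (hanti : Antitone η) (N : ℕ) (hb : ∀ t < N, ∀ e ∈ A, r t e ≤ b t) :
    ∀ n ≤ N, ∀ η' > 0, (∀ t < n, η' ≤ η t) →
      Real.log ((∑ e ∈ A, Real.exp (η' * ∑ s ∈ range n, r s e)) / #A) / η' ≤
        ∑ t ∈ range n, (∑ e ∈ A, softmax A (η t) (fun e => ∑ s ∈ range t, r s e) e * r t e +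
          η t / 2 * ∑ e ∈ A, softmax A (η t) (fun e => ∑ s ∈ range t, r s e) e *
            (b t - r t e) ^ 2) := by
  have hN : (0 : ℝ) < #A := by exact_mod_cast hA.card_pos
  intro n
  induction n with
  | zero => intro _ η' _ _; simp [div_self hN.ne']
  | succ n ih =>
    -- The potential is first moved up from `η'` to the rate `η n` of the current round. The
    -- induction hypothesis holds for every smaller rate, so it can be used at `η n` too.
    intro hn η' hη' hle
    refine (log_mean_exp_div_mono hA _ hη' (hle n (by omega))).trans ?_
    rw [Finset.sum_range_succ]
    have h1 := ih (by omega) (η n) (hη n) (fun t ht => hanti ht.le)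
    set Rn := fun e => ∑ s ∈ range n, r s e with hRn
    have h2 := log_sum_mul_exp_le (r := r n) hA (fun e _ => softmax_pos hA (η n) Rn e)
      (sum_softmax hA (η n) Rn) (hη n) (hb n (by omega))
    have hW := sum_exp_pos hA fun e => η n * Rn e
    -- One round multiplies the partition function by the `softmax` average of `exp (η r)`.
    have h3 : (∑ e ∈ A, Real.exp (η n * ∑ s ∈ range (n + 1), r s e)) / #A =
        ((∑ e ∈ A, Real.exp (η n * Rn e)) / #A) *
          ∑ e ∈ A, softmax A (η n) Rn e * Real.exp (η n * r n e) := by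
      have : ∀ e ∈ A, Real.exp (η n * ∑ s ∈ range (n + 1), r s e) =
          (∑ e ∈ A, Real.exp (η n * Rn e)) *
            (softmax A (η n) Rn e * Real.exp (η n * r n e)) := by
        intro e _
        rw [Finset.sum_range_succ, mul_add, Real.exp_add, softmax]
        field_simp
        rfl
      rw [Finset.sum_congr rfl this, ← Finset.mul_sum]
      ring
    rw [h3, Real.log_mul (div_pos hW hN).ne', add_div]
    · refine add_le_add h1 ?_
      rw [div_le_iff₀ (hη n), mul_comm _ (η n)]
      exact h2
    · exact (Finset.sum_pos (fun e _ => mul_pos (softmax_pos hA _ _ e) (Real.exp_pos _)) hA).ne'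

/-- Abel summation. The terms `x t` may have either sign, so the weights cannot be bounded one by
one; only the partial sums are controlled. -/
theorem sum_mul_le_of_partial_sums_le (η x : ℕ → ℝ) (hanti : Antitone η) {K : ℝ} (n : ℕ)
    (hK : ∀ k ≤ n, ∑ t ∈ range (k + 1), x t ≤ K) :
    ∑ t ∈ range (n + 1), η t * x t ≤ (η 0 - η n) * K + η n * ∑ t ∈ range (n + 1), x t := by
  induction n with
  | zero => simp
  | succ n ih =>
    have h1 := ih fun k hk => hK k (by omega)
    have h2 := hK n (by omega)
    have h3 := hanti (Nat.le_succ n)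
    rw [Finset.sum_range_succ, Finset.sum_range_succ _ (n + 1)]
    nlinarith [mul_le_mul_of_nonneg_left h2 (sub_nonneg.2 h3)]

/-- Second-order regret bound: when some expert is within `Δ` of the best one in every round, the
regret of exponential weights scales with `Δ`. -/
theorem softmax_regret_le (hA : A.Nonempty) (r : ℕ → ι → ℝ) (η : ℕ → ℝ) (hη : ∀ t, 0 < η t)
    (hanti : Antitone η) (hη4 : η 0 ≤ 1 / 4) {Δ : ℝ} (hΔ : 0 ≤ Δ) (N : ℕ)
    (hr0 : ∀ t < N, ∀ e ∈ A, 0 ≤ r t e) (hr1 : ∀ t < N, ∀ e ∈ A, r t e ≤ 1)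
    {z : ι} (hz : z ∈ A) (hrz : ∀ t < N, ∀ e ∈ A, r t e ≤ r t z + Δ) (hN : 0 < N) {e : ι}
    (he : e ∈ A) :
    ∑ t ∈ range N, (r t e -
        ∑ e' ∈ A, softmax A (η t) (fun e => ∑ s ∈ range t, r s e) e' * r t e') ≤
      8 / 7 * (Real.log (#A) / η (N - 1) + 1 / 2 * ∑ t ∈ range N, η t * Δ) := by
  classical
  have hcard : (0 : ℝ) < #A := by exact_mod_cast hA.card_pos
  have hL : 0 ≤ Real.log (#A) := Real.log_nonneg (by exact_mod_cast hA.card_pos)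
  set E : ℕ → ℝ := fun t =>
    ∑ e' ∈ A, softmax A (η t) (fun e => ∑ s ∈ range t, r s e) e' * r t e' with hE
  set B := Real.log (#A) / η (N - 1) + 1 / 2 * ∑ t ∈ range N, η t * Δ with hB
  have hB0 : 0 ≤ B := by
    have := (hη (N - 1)).le
    have : 0 ≤ ∑ t ∈ range N, η t * Δ := Finset.sum_nonneg fun t _ => mul_nonneg (hη t).le hΔ
    positivity
  -- Self-bounding inequality: the regret against `z` itself reappears on the right, weighted by the
  -- learning rates.
  have basic : ∀ n < N, ∀ e ∈ A, ∑ t ∈ range (n + 1), (r t e - E t) ≤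
      B + 1 / 2 * ∑ t ∈ range (n + 1), η t * (r t z - E t) := by
    intro n hn e he
    have h := log_mean_exp_le_sum hA r (fun t => min 1 (r t z + Δ)) η hη hanti N
      (fun t ht e he => le_min (hr1 t ht e he) (hrz t ht e he)) (n + 1) hn (η n) (hη n)
      (fun t ht => hanti (by omega))
    have hlow : ∑ t ∈ range (n + 1), r t e - Real.log (#A) / η n ≤
        Real.log ((∑ e ∈ A, Real.exp (η n * ∑ s ∈ range (n + 1), r s e)) / #A) / η n := by
      rw [Real.log_div (sum_exp_pos hA _).ne' hcard.ne', sub_div, sub_le_sub_iff_right,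
        le_div_iff₀ (hη n)]
      rw [Real.le_log_iff_exp_le (sum_exp_pos hA _), mul_comm]
      exact Finset.single_le_sum (f := fun e => Real.exp (η n * ∑ s ∈ range (n + 1), r s e))
        (fun _ _ => (Real.exp_pos _).le) he
    -- The cap of the envelope at `1` gives `0 ≤ b - r ≤ 1`, hence `(b - r)² ≤ b - r`: the second
    -- moment becomes a first moment.
    have hsq : ∀ t ∈ range (n + 1),
        ∑ e ∈ A, softmax A (η t) (fun e => ∑ s ∈ range t, r s e) e *
          (min 1 (r t z + Δ) - r t e) ^ 2 ≤ Δ + (r t z - E t) := by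
      intro t ht
      have htN : t < N := by have := Finset.mem_range.1 ht; omega
      calc _ ≤ ∑ e ∈ A, softmax A (η t) (fun e => ∑ s ∈ range t, r s e) e *
            (r t z + Δ - r t e) := by
            refine Finset.sum_le_sum fun e he => ?_
            refine mul_le_mul_of_nonneg_left ?_ (softmax_pos hA _ _ e).le
            have a1 := le_min (hr1 t htN e he) (hrz t htN e he)
            have a2 := min_le_left 1 (r t z + Δ)
            have a3 := min_le_right 1 (r t z + Δ)
            have a4 := hr0 t htN e he
            nlinarith
        _ = Δ + (r t z - E t) := by
            simp only [mul_sub, Finset.sum_sub_distrib, ← Finset.sum_mul, sum_softmax hA, hE]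
            ring
    have hlog : Real.log (#A) / η n ≤ Real.log (#A) / η (N - 1) :=
      div_le_div_of_nonneg_left hL (hη _) (hanti (by omega))
    have hsum : ∑ t ∈ range (n + 1), (E t + η t / 2 *
        ∑ e ∈ A, softmax A (η t) (fun e => ∑ s ∈ range t, r s e) e *
            (min 1 (r t z + Δ) - r t e) ^ 2) ≤
        ∑ t ∈ range (n + 1), (E t + (1 / 2 * (η t * Δ) + 1 / 2 * (η t * (r t z - E t)))) := by
      refine Finset.sum_le_sum fun t ht => ?_
      have := mul_le_mul_of_nonneg_left (hsq t ht) (hη t).le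
      linarith
    have htot := hlow.trans (h.trans hsum)
    rw [Finset.sum_add_distrib, Finset.sum_add_distrib, ← Finset.mul_sum, ← Finset.mul_sum] at htot
    have hmono : ∑ t ∈ range (n + 1), η t * Δ ≤ ∑ t ∈ range N, η t * Δ :=
      Finset.sum_le_sum_of_subset_of_nonneg (Finset.range_subset_range.2 hn)
        fun t _ _ => mul_nonneg (hη t).le hΔ
    rw [Finset.sum_sub_distrib]
    linarith
  -- At the first `n` exceeding the bound, the partial sum `X` is the largest so far, so the
  -- weighted sum is at most `η 0 * X ≤ X / 4`. Then `X ≤ B + X / 8`, that is `X ≤ 8/7 * B`.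
  have main : ∀ n < N, ∑ t ∈ range (n + 1), (r t z - E t) ≤ 8 / 7 * B := by
    intro n
    induction n using Nat.strong_induction_on with
    | _ n ih =>
      intro hn
      by_contra! hlt
      have hb := basic n hn z hz
      set X := ∑ t ∈ range (n + 1), (r t z - E t) with hX
      have hK : ∀ k ≤ n, ∑ t ∈ range (k + 1), (r t z - E t) ≤ X := by
        intro k hk
        rcases hk.lt_or_eq with hk | rfl
        · exact (ih k hk (by omega)).trans hlt.le
        · exact le_rfl
      have hab := sum_mul_le_of_partial_sums_le η (fun t => r t z - E t) hanti n hK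
      have : η 0 * X ≤ 1 / 4 * X := mul_le_mul_of_nonneg_right hη4 (by linarith)
      nlinarith
  obtain ⟨n, rfl⟩ : ∃ n, N = n + 1 := ⟨N - 1, by omega⟩
  have hb := basic n (by omega) e he
  have hab := sum_mul_le_of_partial_sums_le η (fun t => r t z - E t) hanti (K := 8 / 7 * B) n
    fun k hk => main k (by omega)
  have hm := mul_le_mul_of_nonneg_left (main n (by omega)) (hη n).le
  -- For a general expert, `B + 1/2 * 1/4 * (8/7 * B)` is again `8/7 * B`.
  have : η 0 * (8 / 7 * B) ≤ 1 / 4 * (8 / 7 * B) :=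
    mul_le_mul_of_nonneg_right hη4 (by linarith)
  linarith

theorem sum_inv_sqrt_le (n : ℕ) : ∑ t ∈ range n, 1 / √((t : ℝ) + 1) ≤ 2 * √n := by
  induction n with
  | zero => simp
  | succ n ih =>
    rw [Finset.sum_range_succ]
    have h0 : (0 : ℝ) ≤ n := n.cast_nonneg
    have hs : 0 < √((n : ℝ) + 1) := Real.sqrt_pos.2 (by linarith)
    have h1 : 1 / √((n : ℝ) + 1) ≤ 2 * √((n : ℝ) + 1) - 2 * √n := by
      rw [div_le_iff₀ hs]
      have e1 := Real.sq_sqrt h0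
      have e2 := Real.sq_sqrt (show (0 : ℝ) ≤ n + 1 by linarith)
      nlinarith [sq_nonneg (√((n : ℝ) + 1) - √n)]
    push_cast
    linarith

/-- Regret of exponential weights with learning rates `min (1/4) √(log |A| / (t Δ))`. -/
theorem softmax_regret_le_sqrt (r : ℕ → ι → ℝ) {Δ : ℝ} (hΔ : 0 < Δ) (N : ℕ) {η : ℕ → ℝ}
    (hη : ∀ t, η t = min (1 / 4) (√(Real.log (#A) / ((t + 1 : ℕ) * Δ))))
    (hr0 : ∀ t < N, ∀ e ∈ A, 0 ≤ r t e) (hr1 : ∀ t < N, ∀ e ∈ A, r t e ≤ 1)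
    {z : ι} (hz : z ∈ A) (hrz : ∀ t < N, ∀ e ∈ A, r t e ≤ r t z + Δ) {e : ι} (he : e ∈ A) :
    ∑ t ∈ range N, (r t e -
        ∑ e' ∈ A, softmax A (η t) (fun e => ∑ s ∈ range t, r s e) e' * r t e') ≤
      5 * Real.log (#A) + 3 * √(N * Δ * Real.log (#A)) := by
  have hA : A.Nonempty := ⟨z, hz⟩
  rcases Nat.eq_zero_or_pos N with rfl | hN
  · simp only [range_zero, sum_empty]
    have : 0 ≤ Real.log (#A) := Real.log_nonneg (by exact_mod_cast hA.card_pos)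
    positivity
  rcases (Nat.succ_le_of_lt hA.card_pos).eq_or_lt with h1 | h1
  -- With a single expert `log |A| = 0` and the learning rate vanishes, so the general bound does
  -- not apply; the regret is zero.
  · obtain ⟨a, rfl⟩ := Finset.card_eq_one.1 h1.symm
    rw [Finset.mem_singleton] at he
    subst he
    have : ∀ t, softmax {e} (η t) (fun e => ∑ s ∈ range t, r s e) e = 1 := by
      intro t; simpa using sum_softmax (hA) (η t) (fun e => ∑ s ∈ range t, r s e)
    simp [this]
  set L := Real.log (#A) with hLdef
  have hL : 0 < L := Real.log_pos (by exact_mod_cast h1)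
  have hηpos : ∀ t, 0 < η t := by
    intro t
    rw [hη]
    exact lt_min (by norm_num) (Real.sqrt_pos.2 (by positivity))
  have hanti : Antitone η := by
    intro s t hst
    rw [hη, hη]
    gcongr
  have h := softmax_regret_le hA r η hηpos hanti (by rw [hη]; exact min_le_left _ _) hΔ.le N hr0
    hr1 hz hrz hN he
  refine h.trans ?_
  have hN' : (0 : ℝ) < N := by exact_mod_cast hN
  -- The two summands correspond to the two branches of the minimum. With `i2` the total is `8/7 *
  -- (4 L + 2 √(N Δ L))`, below `5 L + 3 √(N Δ L)`.
  have i1 : L / η (N - 1) ≤ 4 * L + √(N * Δ * L) := by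
    have hcast : ((N - 1 + 1 : ℕ) : ℝ) = N := by congr 1; omega
    rw [hη, hcast]
    rcases min_choice (1 / 4) (√(L / (N * Δ))) with hm | hm
    · rw [hm]
      have := Real.sqrt_nonneg (N * Δ * L)
      linarith
    · rw [hm]
      have e1 : L = √(N * Δ * L) * √(L / (N * Δ)) := by
        rw [← Real.sqrt_mul (by positivity)]
        rw [show N * Δ * L * (L / (N * Δ)) = L ^ 2 by field_simp]
        rw [Real.sqrt_sq hL.le]
      have hs : 0 < √(L / (N * Δ)) := Real.sqrt_pos.2 (by positivity)
      have : L / √(L / (N * Δ)) = √(N * Δ * L) := by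
        rw [div_eq_iff hs.ne']; exact e1
      linarith
  have i2 : ∑ t ∈ range N, η t * Δ ≤ 2 * √(N * Δ * L) := by
    have hle : ∀ t ∈ range N, η t * Δ ≤ √(Δ * L) * (1 / √((t : ℝ) + 1)) := by
      intro t _
      have e1 : η t ≤ √(L / ((t + 1 : ℕ) * Δ)) := by rw [hη]; exact min_le_right _ _
      calc η t * Δ ≤ √(L / ((t + 1 : ℕ) * Δ)) * Δ := by gcongr
        _ = √(L / ((t + 1 : ℕ) * Δ)) * √(Δ ^ 2) := by rw [Real.sqrt_sq hΔ.le]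
        _ = √(Δ * L / ((t : ℝ) + 1)) := by
          rw [← Real.sqrt_mul (by positivity)]
          congr 1
          push_cast
          field_simp
        _ = √(Δ * L) * (1 / √((t : ℝ) + 1)) := by
          rw [Real.sqrt_div (by positivity)]; ring
    refine (Finset.sum_le_sum hle).trans ?_
    rw [← Finset.mul_sum, mul_assoc (N : ℝ), Real.sqrt_mul hN'.le]
    have := mul_le_mul_of_nonneg_left (sum_inv_sqrt_le N) (Real.sqrt_nonneg (Δ * L))
    linarith
  have := Real.sqrt_nonneg (N * Δ * L)
  linarith

end FirstPrice

namespace FirstPrice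

/-! ### Rounding -/

theorem eps_pos (m : ℕ) : 0 < eps m := by unfold eps; positivity

theorem disc_nonneg (x : ℝ) {y : ℝ} (hy : 0 ≤ y) : 0 ≤ disc x y := by unfold disc; positivity

theorem disc_le {x y : ℝ} (hx : 0 ≤ x) (hy : 0 < y) : disc x y ≤ x := by
  unfold disc
  rw [← le_div_iff₀ hy]
  exact Nat.floor_le (by positivity)

theorem lt_disc_add (x : ℝ) {y : ℝ} (hy : 0 < y) : x < disc x y + y := by
  have := Nat.lt_floor_add_one (x / y)
  rw [div_lt_iff₀ hy] at this
  unfold disc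
  linarith

/-- Rounding down loses nothing against competitors on the lattice. The integer `k` may be negative,
since a refinement can also lower the bid. -/
theorem intCast_div_le_disc {T : ℕ} (hT : 0 < T) {k : ℤ} {y : ℝ} (hy : 0 ≤ y)
    (h : (k : ℝ) / T ≤ y) : (k : ℝ) / T ≤ disc y (1 / T) := by
  have hT' : (0 : ℝ) < T := by exact_mod_cast hT
  have h1 : (k : ℝ) ≤ y / (1 / T) := by
    rw [div_le_iff₀ hT'] at h
    rwa [div_div_eq_mul_div, div_one]
  have h2 : k ≤ ⌊y / (1 / (T : ℝ))⌋ := Int.le_floor.2 h1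
  rw [← Int.natCast_floor_eq_floor (by positivity)] at h2
  have h3 : (k : ℝ) ≤ (⌊y / (1 / (T : ℝ))⌋₊ : ℝ) := by exact_mod_cast h2
  unfold disc
  rw [div_eq_mul_one_div]
  gcongr

/-- The grids are nested with ratio `2 ^ (M - m)`, so rounding can pass through the finer grid
first. -/
theorem floor_div_eps {m M : ℕ} (hm : m ≤ M) (v : ℝ) :
    ⌊v / eps m⌋₊ = ⌊v / eps M⌋₊ / 2 ^ (M - m) := by
  rw [← Nat.floor_div_natCast]
  congr 1
  obtain ⟨k, rfl⟩ := Nat.exists_eq_add_of_le hm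
  simp only [eps, Nat.add_sub_cancel_left, pow_add]
  push_cast
  field_simp

theorem floor_disc_div_eps {m M : ℕ} (hm : m ≤ M) (v : ℝ) :
    ⌊disc v (eps M) / eps m⌋₊ = ⌊v / eps m⌋₊ := by
  rw [floor_div_eps hm, floor_div_eps hm v]
  unfold disc
  rw [mul_div_cancel_right₀ _ (eps_pos M).ne', Nat.floor_natCast]

theorem disc_disc_eps {m M : ℕ} (hm : m ≤ M) (v : ℝ) :
    disc (disc v (eps M)) (eps m) = disc v (eps m) := by
  rw [disc, floor_disc_div_eps hm, ← disc]

theorem disc_eps_mono (v : ℝ) {m M : ℕ} (hm : m ≤ M) :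
    disc v (eps m) ≤ disc v (eps M) := by
  rw [← disc_disc_eps hm]
  exact disc_le (disc_nonneg _ (eps_pos M).le) (eps_pos m)

theorem gridFloor_disc {m M : ℕ} (hm : m ≤ M) (v : ℝ) :
    gridFloor m (disc v (eps M)) = gridFloor m v := by
  simp only [gridFloor, floor_disc_div_eps hm]

/-! ### Nodes of the tree -/

/-- The sequences of edges leading from the root to a node of the tree. -/
inductive IsNode (T M : ℕ) (ζ₀ : GridFun M) : Node → Prop
  | nil : IsNode T M ζ₀ []
  | cons {h : Node} {e : Edge} : IsNode T M ζ₀ h → e ∈ edges T M ζ₀ h → IsNode T M ζ₀ (e :: h)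

variable {T M : ℕ} {ζ₀ : GridFun M}

theorem mem_edges_iff {h : Node} {e : Edge} : e ∈ edges T M ζ₀ h ↔
    level h < M ∧ (e ∈ refinements T h ∨ e = ⟨M, jump T M ζ₀ h⟩) := by
  unfold edges
  split_ifs with hl <;> simp [hl, or_comm]

theorem jump_mem_edges {h : Node} (hl : level h < M) :
    (⟨M, jump T M ζ₀ h⟩ : Edge) ∈ edges T M ζ₀ h :=
  mem_edges_iff.2 ⟨hl, Or.inr rfl⟩

theorem mem_refinements_nil {e : Edge} : e ∈ refinements T [] ↔
    ∃ π ∈ discPolicies T 1, (⟨1, π⟩ : Edge) = e := by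
  simp [refinements]

theorem mem_refinements_cons {d e : Edge} {h : Node} : e ∈ refinements T (d :: h) ↔
    ∃ π ∈ discPolicies T (d.1 + 1), (∀ i, π (refineIdx d.1 i) = d.2 i) ∧
      (⟨d.1 + 1, π⟩ : Edge) = e := by
  obtain ⟨m, σ⟩ := d
  simp [refinements, and_assoc]

theorem mem_discPolicies_iff {m : ℕ} {π : GridFun m} : π ∈ discPolicies T m ↔
    (∀ i, π i ∈ bidGrid T) ∧ ∀ i j, |π i - π j| ≤ 2 * |gridPt m i - gridPt m j| := by
  simp [discPolicies]

theorem mem_refinements {h : Node} {e : Edge} (he : e ∈ refinements T h) :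
    e.1 = level h + 1 ∧ e.2 ∈ discPolicies T e.1 := by
  rcases h with _ | ⟨d, h⟩
  · obtain ⟨π, hπ, rfl⟩ := mem_refinements_nil.1 he
    exact ⟨rfl, hπ⟩
  · obtain ⟨π, hπ, -, rfl⟩ := mem_refinements_cons.1 he
    exact ⟨rfl, hπ⟩

theorem level_le_of_mem_edges {h : Node} {e : Edge} (he : e ∈ edges T M ζ₀ h) : e.1 ≤ M := by
  obtain ⟨hl, he | rfl⟩ := mem_edges_iff.1 he
  · have := (mem_refinements he).1
    omega
  · exact le_rfl

theorem IsNode.level_le {h : Node} (hh : IsNode T M ζ₀ h) : level h ≤ M := by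
  cases hh with
  | nil => exact Nat.zero_le _
  | cons _ he => exact level_le_of_mem_edges he

theorem IsNode.mem_discPolicies {e : Edge} {h : Node} (hh : IsNode T M ζ₀ (e :: h))
    (he : e.1 < M) : e.2 ∈ discPolicies T e.1 := by
  cases hh with
  | cons _ he' =>
    obtain ⟨-, he' | rfl⟩ := mem_edges_iff.1 he'
    · exact (mem_refinements he').2
    · exact absurd he (lt_irrefl _)

theorem bidGrid_nonneg {b : ℝ} (hb : b ∈ bidGrid T) : 0 ≤ b := by
  simp only [bidGrid, Finset.mem_image] at hb
  obtain ⟨j, -, rfl⟩ := hb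
  positivity

theorem IsNode.nonneg (hζ : ∀ i, 0 ≤ ζ₀ i) {e : Edge} {h : Node}
    (hh : IsNode T M ζ₀ (e :: h)) (i : Fin (2 ^ e.1 + 1)) : 0 ≤ e.2 i := by
  cases hh with
  | cons hh he =>
    obtain ⟨hl, he | rfl⟩ := mem_edges_iff.1 he
    · exact bidGrid_nonneg ((mem_discPolicies_iff.1 (mem_refinements he).2).1 i)
    · rcases h with _ | ⟨d, h⟩
      · exact hζ i
      · have h1 := bidGrid_nonneg ((mem_discPolicies_iff.1 (hh.mem_discPolicies hl)).1
          (gridFloor d.1 (gridPt M i)))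
        exact add_nonneg h1 (disc_nonneg _ (by positivity))

/-! ### Mixtures of rewards -/

/-- This turns each node into an expert problem whose experts are the subtrees hanging from its
edges. -/
theorem mixtureReward_eq_sum (q : Node → Edge → ℝ) {h : Node} (hl : level h < M)
    (lam v mb : ℝ) : mixtureReward T M ζ₀ q h lam v mb =
      ∑ e ∈ edges T M ζ₀ h, q h e * mixtureReward T M ζ₀ q (e :: h) lam v mb := by
  have hmix : ∀ π, mixture T M ζ₀ q h π =
      ∑ e ∈ edges T M ζ₀ h, q h e * mixture T M ζ₀ q (e :: h) π := by
    intro π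
    rw [mixture, if_pos hl, Finset.sum_attach _ fun e => q h e * mixture T M ζ₀ q (e :: h) π]
  simp only [mixtureReward, hmix, Finset.sum_mul, Finset.mul_sum]
  rw [Finset.sum_comm]
  simp only [mul_assoc]

theorem IsNode.terminalBelow_subset {h : Node} (hh : IsNode T M ζ₀ h) :
    terminalBelow T M ζ₀ h ⊆ terminalPolicies T M ζ₀ := by
  induction hh with
  | nil => exact Finset.Subset.refl _
  | @cons h e _ he ih =>
    refine Finset.Subset.trans ?_ ih
    intro π hπ
    rw [terminalBelow, if_pos (level_lt_of_mem_edges he).2]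
    exact Finset.mem_biUnion.2 ⟨⟨e, he⟩, Finset.mem_attach _ _, hπ⟩

theorem mixtureReward_terminal (q : Node → Edge → ℝ) {e : Edge} {h : Node}
    (hh : IsNode T M ζ₀ (e :: h)) (he : e.1 = M) (lam v mb : ℝ) :
    mixtureReward T M ζ₀ q (e :: h) lam v mb = instReward e lam v mb := by
  have hl : ¬ level (e :: h) < M := by simp [level, he]
  have hmem : e ∈ terminalPolicies T M ζ₀ := by
    apply hh.terminalBelow_subset
    rw [terminalBelow, if_neg hl]
    simp
  unfold mixtureReward
  rw [Finset.sum_eq_single_of_mem e hmem]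
  · rw [mixture, if_neg hl]
    simp
  · intro π _ hπ
    rw [mixture, if_neg hl]
    simp [hπ.symm]

/-- Averages stay in an interval containing the leaf rewards. The predicate `P`, inherited by
children, restricts attention to a subtree and carries what is known about its leaves. -/
theorem mixtureReward_mem_Icc (hM : 0 < M) {q : Node → Edge → ℝ}
    (hq0 : ∀ h, level h < M → ∀ e ∈ edges T M ζ₀ h, 0 ≤ q h e)
    (hq1 : ∀ h, level h < M → ∑ e ∈ edges T M ζ₀ h, q h e = 1)
    {a b lam v mb : ℝ} (P : Node → Prop) (hP : ∀ h, P h → IsNode T M ζ₀ h)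
    (hPe : ∀ h, P h → ∀ e ∈ edges T M ζ₀ h, P (e :: h))
    (hab : ∀ e h, P (e :: h) → e.1 = M → instReward e lam v mb ∈ Set.Icc a b) :
    ∀ h, P h → mixtureReward T M ζ₀ q h lam v mb ∈ Set.Icc a b := by
  suffices H : ∀ n h, M - level h = n → P h →
      mixtureReward T M ζ₀ q h lam v mb ∈ Set.Icc a b from fun h => H _ h rfl
  intro n
  induction n using Nat.strong_induction_on with
  | _ n ih =>
    intro h hn hh
    by_cases hl : level h < M
    · rw [mixtureReward_eq_sum q hl]
      refine (convex_Icc a b).sum_mem (hq0 h hl) (hq1 h hl) fun e he => ?_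
      refine ih (M - level (e :: h)) ?_ _ rfl (hPe h hh e he)
      have := (level_lt_of_mem_edges he).1
      simp only [level] at *
      omega
    · have hle := (hP h hh).level_le
      rcases h with _ | ⟨e, h⟩
      · exact absurd hM hl
      · have he : e.1 = M := le_antisymm hle (not_lt.1 hl)
        rw [mixtureReward_terminal q (hP _ hh) he]
        exact hab e h hh he

/-! ### Rewards of thresholded policies -/

/-- The value of the last policy of an edge at the grid point below `v`. -/
noncomputable def edgeVal (e : Edge) (v : ℝ) : ℝ := e.2 (gridFloor e.1 v)

theorem thresholded_eq (e : Edge) (v lam : ℝ) :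
    thresholded e v lam = min (edgeVal e v + 2 * eps e.1) (v / (1 + lam)) := rfl

theorem one_add_mul_thresholded_le (e : Edge) (v : ℝ) {lam : ℝ} (hlam : 0 ≤ lam) :
    (1 + lam) * thresholded e v lam ≤ v := by
  have h : thresholded e v lam ≤ v / (1 + lam) := min_le_right _ _
  rwa [le_div_iff₀ (by linarith), mul_comm] at h

theorem instReward_nonneg (e : Edge) (v mb : ℝ) {lam : ℝ} (hlam : 0 ≤ lam) :
    0 ≤ instReward e lam v mb := by
  unfold instReward
  split_ifs
  · linarith [one_add_mul_thresholded_le e v hlam]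
  · exact le_rfl

theorem instReward_le_one {e : Edge} {v lam : ℝ} (mb : ℝ) (hlam : 0 ≤ lam) (hv : v ∈ Set.Icc 0 1)
    (he : 0 ≤ edgeVal e v) : instReward e lam v mb ≤ 1 := by
  have h0 : 0 ≤ thresholded e v lam :=
    le_min (add_nonneg he (by linarith [eps_pos e.1])) (div_nonneg hv.1 (by linarith))
  unfold instReward
  split_ifs
  · nlinarith [hv.2]
  · exact zero_le_one

/-- Raising the bid by at most `c` costs at most `(1 + lam) c`. -/
theorem instReward_le_add {e e' : Edge} {v lam c : ℝ} (mb : ℝ) (hlam : 0 ≤ lam)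
    (h1 : thresholded e v lam ≤ thresholded e' v lam)
    (h2 : thresholded e' v lam ≤ thresholded e v lam + c) :
    instReward e lam v mb ≤ instReward e' lam v mb + (1 + lam) * c := by
  have hc : 0 ≤ (1 + lam) * c := mul_nonneg (by linarith) (by linarith)
  by_cases hw : mb ≤ thresholded e v lam
  · rw [instReward, instReward, if_pos hw, if_pos (hw.trans h1)]
    nlinarith
  · rw [instReward, if_neg hw]
    linarith [instReward_nonneg e' v mb hlam]

theorem edgeVal_jump {d : Edge} (h : Node) (hd : d.1 ≤ M) {v : ℝ} (hv : v ≤ 1) :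
    edgeVal ⟨M, jump T M ζ₀ (d :: h)⟩ v = edgeVal d v +
      disc (2 * (disc v (eps M) - disc v (eps d.1))) (1 / T) := by
  obtain ⟨m, σ⟩ := d
  simp only [edgeVal, jump]
  rw [gridPt_gridFloor _ hv, gridFloor_disc hd, disc_disc_eps hd]

/-- Moving along an edge changes the value at `v` by a multiple of `1 / T`, and by at most twice
the distance between the grid points below `v`. -/
theorem edgeVal_step {d e : Edge} {h : Node} (hT : 0 < T)
    (he : e ∈ edges T M ζ₀ (d :: h)) {v : ℝ} (hv : v ∈ Set.Icc 0 1) :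
    |edgeVal e v - edgeVal d v| ≤ 2 * (disc v (eps e.1) - disc v (eps d.1)) ∧
      ∃ k : ℤ, edgeVal e v - edgeVal d v = k / T := by
  have hT' : (0 : ℝ) < T := by exact_mod_cast hT
  obtain ⟨hl, he | rfl⟩ := mem_edges_iff.1 he
  · obtain ⟨π, hπ, hr, rfl⟩ := mem_refinements_cons.1 he
    obtain ⟨hg, hlip⟩ := mem_discPolicies_iff.1 hπ
    have e1 : edgeVal d v = π (refineIdx d.1 (gridFloor d.1 v)) := (hr _).symm
    rw [e1]
    constructor
    · refine (hlip _ _).trans_eq ?_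
      rw [gridPt_refineIdx, gridPt_gridFloor _ hv.2, gridPt_gridFloor _ hv.2,
        abs_of_nonneg (sub_nonneg.2 (disc_eps_mono v (Nat.le_succ _)))]
    · have h1 := hg (gridFloor (d.1 + 1) v)
      have h2 := hg (refineIdx d.1 (gridFloor d.1 v))
      simp only [bidGrid, Finset.mem_image] at h1 h2
      obtain ⟨j, -, hj⟩ := h1
      obtain ⟨k, -, hk⟩ := h2
      refine ⟨(j : ℤ) - k, ?_⟩
      change π (gridFloor (d.1 + 1) v) - _ = _
      rw [← hj, ← hk]
      push_cast
      ring
  · have hdM : d.1 ≤ M := hl.le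
    have e1 := edgeVal_jump (T := T) (ζ₀ := ζ₀) h hdM hv.2
    have h0 : 0 ≤ 2 * (disc v (eps M) - disc v (eps d.1)) := by
      linarith [disc_eps_mono v hdM]
    rw [e1, add_sub_cancel_left]
    constructor
    · rw [abs_of_nonneg (disc_nonneg _ (by positivity))]
      exact disc_le h0 (by positivity)
    · refine ⟨⌊2 * (disc v (eps M) - disc v (eps d.1)) / (1 / T)⌋₊, ?_⟩
      simp only [disc]
      push_cast
      ring

/-- The jump policy is nearly optimal among all policies below `h`. -/
theorem mixtureReward_le_jump (hT : 0 < T) (hM : 0 < M) {q : Node → Edge → ℝ}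
    (hq0 : ∀ h, level h < M → ∀ e ∈ edges T M ζ₀ h, 0 ≤ q h e)
    (hq1 : ∀ h, level h < M → ∑ e ∈ edges T M ζ₀ h, q h e = 1)
    {d : Edge} {h : Node} (hd : IsNode T M ζ₀ (d :: h)) (hl : d.1 < M)
    {ρ lam v : ℝ} (mb : ℝ) (hv : v ∈ Set.Icc 0 1) (hlam : lam ∈ Set.Icc 0 (1 / ρ))
    {e : Edge} (he : e ∈ edges T M ζ₀ (d :: h)) :
    mixtureReward T M ζ₀ q (e :: d :: h) lam v mb ≤
      instReward ⟨M, jump T M ζ₀ (d :: h)⟩ lam v mb + gap ρ d.1 := by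
  have hT' : (0 : ℝ) < T := by exact_mod_cast hT
  set ζ : Edge := ⟨M, jump T M ζ₀ (d :: h)⟩
  -- Invariant of the descendants of `d`: the bounds on successive steps telescope, and the value at
  -- `v` stays in the `1/T`-lattice through that of `d`.
  let P : Node → Prop := fun h' => IsNode T M ζ₀ h' ∧ ∃ f l, h' = f :: l ∧ d.1 ≤ f.1 ∧
    |edgeVal f v - edgeVal d v| ≤ 2 * (disc v (eps f.1) - disc v (eps d.1)) ∧
      ∃ k : ℤ, edgeVal f v - edgeVal d v = k / T
  have hPe : ∀ h', P h' → ∀ e ∈ edges T M ζ₀ h', P (e :: h') := by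
    rintro _ ⟨hn, f, l, rfl, hdf, hf, k, hk⟩ e he
    obtain ⟨h1, k', hk'⟩ := edgeVal_step hT he hv
    have hlt := (level_lt_of_mem_edges he).1
    refine ⟨hn.cons he, e, f :: l, rfl, hdf.trans hlt.le, ?_, k + k', ?_⟩
    · have := abs_sub_le (edgeVal e v) (edgeVal f v) (edgeVal d v)
      linarith
    · push_cast
      rw [add_div, ← hk, ← hk']
      ring
  have hPd : P (d :: h) := ⟨hd, d, h, rfl, le_rfl, by simp, 0, by simp⟩
  refine (mixtureReward_mem_Icc hM hq0 hq1 (a := 0)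
    (b := instReward ζ lam v mb + gap ρ d.1) P (fun _ hp => hp.1) hPe ?_ (e :: d :: h)
    (hPe _ hPd e he)).2
  rintro f l ⟨-, f', l', hfl, -, hf, k, hk⟩ hfM
  obtain ⟨rfl, rfl⟩ := List.cons_eq_cons.1 hfl
  refine ⟨instReward_nonneg f v mb hlam.1, ?_⟩
  have hmono := disc_eps_mono v hl.le
  have hζval : edgeVal ζ v = _ := edgeVal_jump h hl.le hv.2
  have h0 : 0 ≤ 2 * (disc v (eps M) - disc v (eps d.1)) := by linarith
  have hdisc := disc_le h0 (show 0 < 1 / (T : ℝ) by positivity)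
  rw [hfM] at hf
  obtain ⟨hf1, hf2⟩ := abs_le.1 hf
  -- The jump policy rises by the largest multiple of `1/T` that the invariant allows, so no leaf
  -- below `d` exceeds it.
  have hle : edgeVal f v ≤ edgeVal ζ v := by
    have := intCast_div_le_disc hT h0 (hk ▸ hf2)
    rw [hζval]
    linarith
  have hM1 : disc v (eps M) - disc v (eps d.1) ≤ eps d.1 := by
    linarith [disc_le hv.1 (eps_pos M), lt_disc_add v (eps_pos d.1)]
  -- A leaf may fall by `2 * eps d.1` while the jump policy rises by as much.
  have hge : edgeVal ζ v ≤ edgeVal f v + 4 * eps d.1 := by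
    rw [hζval]
    linarith
  have hεd := eps_pos d.1
  have hres := instReward_le_add (e := f) (e' := ζ) (c := 4 * eps d.1) mb hlam.1
    (by rw [thresholded_eq, thresholded_eq, hfM]; gcongr)
    (by
      rw [thresholded_eq, thresholded_eq, hfM, ← min_add_add_right]
      refine min_le_min ?_ ?_
      · change edgeVal ζ v + 2 * eps M ≤ _
        linarith
      · linarith)
  refine hres.trans ?_
  have : (1 + lam) * (4 * eps d.1) ≤ gap ρ d.1 := by
    unfold gap
    nlinarith [hlam.2]
  linarith

/-! ### Regret at a node -/

theorem cumReward_eq_sum (ρ : ℝ) (v mb lam : ℕ → ℝ) (t : ℕ) (h : Node) (e : Edge) :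
    cumReward T M ζ₀ ρ v mb lam t h e = ∑ s ∈ range t, mixtureReward T M ζ₀
      (expWeights T M ζ₀ ρ (s + 1) (cumReward T M ζ₀ ρ v mb lam s))
      (e :: h) (lam (s + 1)) (v (s + 1)) (mb (s + 1)) := by
  induction t with
  | zero => rfl
  | succ t ih => rw [Finset.sum_range_succ, ← ih, cumReward]

theorem expWeights_pos (ρ : ℝ) (t : ℕ) (R : Node → Edge → ℝ) {h : Node} (hl : level h < M)
    (e : Edge) : 0 < expWeights T M ζ₀ ρ t R h e :=
  softmax_pos ⟨_, jump_mem_edges hl⟩ _ _ _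

theorem sum_expWeights (ρ : ℝ) (t : ℕ) (R : Node → Edge → ℝ) {h : Node} (hl : level h < M) :
    ∑ e ∈ edges T M ζ₀ h, expWeights T M ζ₀ ρ t R h e = 1 :=
  sum_softmax ⟨_, jump_mem_edges hl⟩ _ _

theorem one_le_gap_zero {ρ : ℝ} (hρ : 0 < ρ) : 1 ≤ gap ρ 0 := by
  have : 0 < 1 / ρ := by positivity
  simp only [gap, eps, pow_zero]
  linarith

theorem node_regret_le (hT : 0 < T) (hM : 0 < M) (hζ : ∀ i, 0 ≤ ζ₀ i) {ρ : ℝ} (hρ : 0 < ρ)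
    {v lam : ℕ → ℝ} (mb : ℕ → ℝ) (N : ℕ) (hv : ∀ t, v t ∈ Set.Icc 0 1)
    (hlam : ∀ t ∈ Icc 1 N, lam t ∈ Set.Icc 0 (1 / ρ)) {h : Node} (hh : IsNode T M ζ₀ h)
    {e : Edge} (he : e ∈ edges T M ζ₀ h) :
    ∑ t ∈ range N, (mixtureReward T M ζ₀
          (expWeights T M ζ₀ ρ (t + 1) (cumReward T M ζ₀ ρ v mb lam t)) (e :: h)
          (lam (t + 1)) (v (t + 1)) (mb (t + 1)) -
        mixtureReward T M ζ₀
          (expWeights T M ζ₀ ρ (t + 1) (cumReward T M ζ₀ ρ v mb lam t)) h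
          (lam (t + 1)) (v (t + 1)) (mb (t + 1))) ≤
      5 * Real.log (#(edges T M ζ₀ h)) +
        3 * √(N * gap ρ (level h) * Real.log (#(edges T M ζ₀ h))) := by
  have hl := (level_lt_of_mem_edges he).2
  set q : ℕ → Node → Edge → ℝ := fun t =>
    expWeights T M ζ₀ ρ (t + 1) (cumReward T M ζ₀ ρ v mb lam t) with hqdef
  set r : ℕ → Edge → ℝ := fun t e =>
    mixtureReward T M ζ₀ (q t) (e :: h) (lam (t + 1)) (v (t + 1)) (mb (t + 1)) with hr
  have hq0 : ∀ t h, level h < M → ∀ e ∈ edges T M ζ₀ h, 0 ≤ q t h e :=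
    fun t h hl e _ => (expWeights_pos _ _ _ hl e).le
  have hq1 : ∀ t h, level h < M → ∑ e ∈ edges T M ζ₀ h, q t h e = 1 :=
    fun t h hl => sum_expWeights _ _ _ hl
  have hlam' : ∀ t < N, lam (t + 1) ∈ Set.Icc 0 (1 / ρ) :=
    fun t ht => hlam _ (Finset.mem_Icc.2 (by omega))
  have hunit : ∀ t < N, ∀ e ∈ edges T M ζ₀ h, r t e ∈ Set.Icc 0 1 := by
    intro t ht e he
    refine mixtureReward_mem_Icc hM (hq0 t) (hq1 t) (IsNode T M ζ₀) (fun _ hp => hp)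
      (fun _ hp _ he => hp.cons he) ?_ _ (hh.cons he)
    intro f l hf _
    exact ⟨instReward_nonneg _ _ _ (hlam' t ht).1,
      instReward_le_one _ (hlam' t ht).1 (hv _) (hf.nonneg hζ _)⟩
  have hgap : 0 < gap ρ (level h) := by
    have := eps_pos (level h)
    unfold gap
    positivity
  have hjump := jump_mem_edges (T := T) (ζ₀ := ζ₀) hl
  have hrz : ∀ t < N, ∀ e ∈ edges T M ζ₀ h,
      r t e ≤ r t ⟨M, jump T M ζ₀ h⟩ + gap ρ (level h) := by
    intro t ht e he
    -- At the root `gap ρ 0 ≥ 1` exceeds the range of the rewards, so the arbitrary `ζ₀` serves as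
    -- the nearly optimal expert.
    rcases h with _ | ⟨d, h⟩
    · linarith [(hunit t ht e he).2, (hunit t ht _ hjump).1, one_le_gap_zero hρ,
        show gap ρ (level []) = gap ρ 0 from rfl]
    · have := mixtureReward_le_jump hT hM (hq0 t) (hq1 t) hh hl (mb (t + 1)) (hv (t + 1))
        (hlam' t ht) he
      rw [← mixtureReward_terminal (q t) (hh.cons hjump) rfl] at this
      exact this
  have key := softmax_regret_le_sqrt r hgap N
    (η := fun t => learningRate T M ζ₀ ρ (t + 1) h) (fun t => rfl)
    (fun t ht e he => (hunit t ht e he).1) (fun t ht e he => (hunit t ht e he).2) hjump hrz he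
  refine le_of_eq_of_le (Finset.sum_congr rfl fun t _ => ?_) key
  rw [mixtureReward_eq_sum _ hl]
  congr 1
  refine Finset.sum_congr rfl fun e' _ => ?_
  congr 1
  simp only [hqdef, expWeights, softmax, cumReward_eq_sum, hr]

end FirstPrice

namespace FirstPrice

variable {T M : ℕ} {ζ₀ : GridFun M}

/-! ### Sizes -/

theorem card_discPolicies_le (T m : ℕ) : #(discPolicies T m) ≤ (T + 1) ^ (2 ^ m + 1) := by
  refine (Finset.card_filter_le _ _).trans ?_
  rw [Fintype.card_piFinset, Finset.prod_const, Finset.card_univ, Fintype.card_fin]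
  refine Nat.pow_le_pow_left ?_ _
  exact Finset.card_image_le.trans_eq (Finset.card_range _)

theorem card_refinements_le (T : ℕ) (h : Node) :
    #(refinements T h) ≤ (T + 1) ^ (2 ^ (level h + 1) + 1) := by
  rcases h with _ | ⟨⟨m, σ⟩, h⟩
  · exact Finset.card_image_le.trans (card_discPolicies_le T 1)
  · exact Finset.card_image_le.trans
      ((Finset.card_filter_le _ _).trans (card_discPolicies_le T (m + 1)))

theorem log_card_edges_le (hT : 2 ≤ T) (h : Node) :
    Real.log (#(edges T M ζ₀ h)) ≤ 8 * 2 ^ level h * Real.log T := by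
  have hT1 : (1 : ℝ) ≤ T := by exact_mod_cast (by omega : 1 ≤ T)
  -- Since `T + 1 ≤ T ^ 2`, the logarithm is `2 * 2 ^ (level h + 2) * log T`, whence the constant
  -- `8`.
  have hcard : #(edges T M ζ₀ h) ≤ (T ^ 2) ^ 2 ^ (level h + 2) := by
    unfold edges
    split_ifs
    · calc _ ≤ (T + 1) ^ (2 ^ (level h + 1) + 1) + 1 :=
            (Finset.card_union_le _ _).trans
              (add_le_add (card_refinements_le T h) (Finset.card_singleton _).le)
        _ ≤ (T + 1) ^ (2 ^ (level h + 1) + 2) := by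
            have : 1 ≤ (T + 1) ^ (2 ^ (level h + 1) + 1) := Nat.one_le_pow _ _ (by omega)
            rw [pow_succ _ (2 ^ (level h + 1) + 1)]
            nlinarith
        _ ≤ (T + 1) ^ 2 ^ (level h + 2) := by
            refine Nat.pow_le_pow_right (by omega) ?_
            have : 1 ≤ 2 ^ level h := Nat.one_le_two_pow
            rw [pow_succ, pow_add]
            omega
        _ ≤ (T ^ 2) ^ 2 ^ (level h + 2) := Nat.pow_le_pow_left (by nlinarith) _
    · simp
  have hlogT : 0 ≤ Real.log T := Real.log_nonneg hT1
  rcases Nat.eq_zero_or_pos #(edges T M ζ₀ h) with h0 | h0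
  · rw [h0]
    simp only [Nat.cast_zero, Real.log_zero]
    positivity
  · have hcard' : (#(edges T M ζ₀ h) : ℝ) ≤ (T ^ 2) ^ 2 ^ (level h + 2) := by exact_mod_cast hcard
    refine (Real.log_le_log (by exact_mod_cast h0) hcard').trans_eq ?_
    rw [Real.log_pow, Real.log_pow]
    push_cast
    ring

/-! ### Consequences of the choice of the number of levels -/

section numLevels

variable (hT : 16 ≤ T)
include hT

theorem one_le_log : 1 ≤ Real.log T := by
  have hT' : (16 : ℝ) ≤ T := by exact_mod_cast hT
  rw [Real.le_log_iff_exp_le (by linarith)]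
  linarith [Real.exp_one_lt_d9]

theorem two_pow_numLevels_le : (2 : ℝ) ^ numLevels T ≤ √T := by
  have hT' : (16 : ℝ) ≤ T := by exact_mod_cast hT
  have hs : 1 ≤ √(T : ℝ) := Real.one_le_sqrt.2 (by linarith)
  rw [← Real.rpow_natCast, ← Real.le_logb_iff_rpow_le one_lt_two (by linarith)]
  exact Nat.floor_le (Real.logb_nonneg one_lt_two hs)

theorem sqrt_lt_two_pow_numLevels : √T < 2 * (2 : ℝ) ^ numLevels T := by
  have hT' : (16 : ℝ) ≤ T := by exact_mod_cast hT
  have hs : 0 < √(T : ℝ) := Real.sqrt_pos.2 (by linarith)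
  rw [← pow_succ', ← Real.rpow_natCast, ← Real.logb_lt_iff_lt_rpow one_lt_two hs]
  push_cast
  exact Nat.lt_floor_add_one _

theorem numLevels_pos : 0 < numLevels T := by
  have hT' : (16 : ℝ) ≤ T := by exact_mod_cast hT
  have hs : (2 : ℝ) ≤ √(T : ℝ) := Real.le_sqrt_of_sq_le (by linarith)
  refine Nat.floor_pos.2 ?_
  rw [Real.le_logb_iff_rpow_le one_lt_two (by linarith), Real.rpow_one]
  exact hs

theorem numLevels_le_log : (numLevels T : ℝ) ≤ Real.log T := by
  have hT' : (16 : ℝ) ≤ T := by exact_mod_cast hT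
  have h := Real.log_le_log (by positivity) (two_pow_numLevels_le hT)
  rw [Real.log_pow, Real.log_sqrt (by linarith)] at h
  have := Real.log_two_gt_d9
  have : (0 : ℝ) ≤ numLevels T := Nat.cast_nonneg _
  nlinarith

theorem inv_le_eps {m : ℕ} (hm : m ≤ numLevels T) : 1 / (T : ℝ) ≤ eps m := by
  have hT' : (16 : ℝ) ≤ T := by exact_mod_cast hT
  have h1 : (2 : ℝ) ^ m ≤ 2 ^ numLevels T := pow_le_pow_right₀ one_le_two hm
  have h2 := two_pow_numLevels_le hT
  have h3 : √(T : ℝ) ≤ T := Real.sqrt_le_iff.2 ⟨by linarith, by nlinarith⟩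
  unfold eps
  exact one_div_le_one_div_of_le (by positivity) (by linarith)

theorem mul_eps_numLevels_le : T * eps (numLevels T) ≤ 2 * √T := by
  have h := sqrt_lt_two_pow_numLevels hT
  unfold eps
  rw [mul_one_div, div_le_iff₀ (by positivity)]
  have := Real.mul_self_sqrt (Nat.cast_nonneg (α := ℝ) T)
  nlinarith [Real.sqrt_nonneg (T : ℝ)]

end numLevels

/-! ### The path of a Lipschitz policy -/

/-- Grid points need not lie in `V`, so the comparator is extended to the line; clipping to `[0, 1]`
preserves the Lipschitz constant. -/
theorem exists_lipschitz_extension {V B : Set ℝ} (hB : B ⊆ Set.Icc 0 1) {π : V → B}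
    (hπ : π ∈ lipschitzPolicies V B) : ∃ p : ℝ → ℝ, (∀ x, p x ∈ Set.Icc 0 1) ∧
      (∀ x y, |p x - p y| ≤ |x - y|) ∧ ∀ x : V, p x = π x := by
  classical
  let f : ℝ → ℝ := fun x => if hx : x ∈ V then π ⟨x, hx⟩ else 0
  have hf : LipschitzOnWith 1 f V := by
    refine LipschitzOnWith.of_dist_le_mul fun x hx y hy => ?_
    simp only [f, dif_pos hx, dif_pos hy, Real.dist_eq, NNReal.coe_one, one_mul]
    exact hπ ⟨x, hx⟩ ⟨y, hy⟩
  obtain ⟨g, hg, hfg⟩ := hf.extend_real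
  refine ⟨fun x => max 0 (min 1 (g x)), fun x => ⟨le_max_left _ _,
    max_le zero_le_one (min_le_left _ _)⟩, fun x y => ?_, fun x => ?_⟩
  · have h1 : |min 1 (g x) - min 1 (g y)| ≤ |g x - g y| := by
      simpa using abs_min_sub_min_le_max 1 (g x) 1 (g y)
    have h2 : |max 0 (min 1 (g x)) - max 0 (min 1 (g y))| ≤ |min 1 (g x) - min 1 (g y)| := by
      simpa using abs_max_sub_max_le_max 0 (min 1 (g x)) 0 (min 1 (g y))
    refine h2.trans (h1.trans ?_)
    simpa [Real.dist_eq] using hg.dist_le_mul x y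
  · have h1 : g x = π x := by
      rw [← hfg x.2]
      simp [f]
    have h2 := hB (π x).2
    simp only
    rw [h1, min_eq_right h2.2, max_eq_right h2.1]

/-- The restriction to the grid `V_{ε_m}` of the rounding of `p` to multiples of `1 / T`. -/
noncomputable def roundedPolicy (T : ℕ) (p : ℝ → ℝ) (m : ℕ) : Edge :=
  ⟨m, fun i => disc (p (gridPt m i)) (1 / T)⟩

/-- The path of the successive roundings of `p`, down to level `m`. -/
noncomputable def roundedPath (T : ℕ) (p : ℝ → ℝ) : ℕ → Node
  | 0 => []
  | m + 1 => roundedPolicy T p (m + 1) :: roundedPath T p m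

theorem level_roundedPath (T : ℕ) (p : ℝ → ℝ) (m : ℕ) : level (roundedPath T p m) = m := by
  cases m <;> rfl

variable {p : ℝ → ℝ} (hp : ∀ x, p x ∈ Set.Icc 0 1) (hlip : ∀ x y, |p x - p y| ≤ |x - y|)
include hp

theorem disc_mem_bidGrid (hT : 0 < T) (x : ℝ) : disc (p x) (1 / T) ∈ bidGrid T := by
  have hT' : (0 : ℝ) < T := by exact_mod_cast hT
  refine Finset.mem_image.2 ⟨⌊p x / (1 / T)⌋₊, Finset.mem_range.2 (Nat.lt_succ_of_le ?_), ?_⟩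
  · refine Nat.floor_le_of_le ?_
    rw [div_le_iff₀ (by positivity), mul_one_div, div_self hT'.ne']
    exact (hp x).2
  · rw [disc, mul_one_div]

include hlip

theorem abs_disc_sub_disc_le (hT : 0 < T) (x y : ℝ) :
    |disc (p x) (1 / T) - disc (p y) (1 / T)| ≤ |x - y| + 1 / T := by
  have hT' : (0 : ℝ) < 1 / T := by positivity
  have h := abs_le.1 (hlip x y)
  rw [abs_le]
  constructor <;>
  linarith [disc_le (hp x).1 hT', disc_le (hp y).1 hT', lt_disc_add (p x) hT',
    lt_disc_add (p y) hT']

/-- Distinct grid points are at least `eps m ≥ 1/T` apart, so the rounding error at most doubles the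
Lipschitz constant; this is why `discPolicies` allows slope `2`. -/
theorem roundedPolicy_mem_discPolicies (hT : 16 ≤ T) {m : ℕ} (hm : m ≤ numLevels T) :
    (roundedPolicy T p m).2 ∈ discPolicies T m := by
  refine mem_discPolicies_iff.2 ⟨fun i => disc_mem_bidGrid hp (by omega) _, fun i j => ?_⟩
  by_cases hij : i = j
  · simp [hij]
  · refine (abs_disc_sub_disc_le hp hlip (by omega) _ _).trans ?_
    have h1 : eps m ≤ |gridPt m i - gridPt m j| := by
      have : (1 : ℝ) ≤ |((i : ℕ) : ℝ) - ((j : ℕ) : ℝ)| := by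
        have h : ((i : ℕ) : ℤ) - (j : ℕ) ≠ 0 := by
          rw [sub_ne_zero]
          exact_mod_cast fun h => hij (Fin.ext h)
        exact_mod_cast Int.one_le_abs h
      rw [gridPt, gridPt, ← sub_mul, abs_mul, abs_of_pos (eps_pos m)]
      nlinarith [eps_pos m]
    linarith [inv_le_eps hT hm]

theorem roundedPolicy_mem_edges (hT : 16 ≤ T) {ζ₀ : GridFun (numLevels T)} {m : ℕ}
    (hm : m < numLevels T) :
    roundedPolicy T p (m + 1) ∈ edges T (numLevels T) ζ₀ (roundedPath T p m) := by
  refine mem_edges_iff.2 ⟨by rwa [level_roundedPath], Or.inl ?_⟩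
  have hmem := roundedPolicy_mem_discPolicies hp hlip hT hm
  cases m with
  | zero => exact mem_refinements_nil.2 ⟨_, hmem, rfl⟩
  | succ m =>
    refine mem_refinements_cons.2 ⟨_, hmem, fun i => ?_, rfl⟩
    exact congrArg (fun x => disc (p x) (1 / T)) (gridPt_refineIdx (m + 1) i)

theorem isNode_roundedPath (hT : 16 ≤ T) {ζ₀ : GridFun (numLevels T)} {m : ℕ}
    (hm : m ≤ numLevels T) : IsNode T (numLevels T) ζ₀ (roundedPath T p m) := by
  induction m with
  | zero => exact IsNode.nil
  | succ m ih => exact (ih (by omega)).cons (roundedPolicy_mem_edges hp hlip hT hm)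

theorem utility_le_instReward (hT : 16 ≤ T) {v lam : ℝ} (mb : ℝ) (hv : v ∈ Set.Icc 0 1)
    (hlam : 0 ≤ lam) : reward v mb (p v) - lam * cost mb (p v) ≤
      instReward (roundedPolicy T p (numLevels T)) lam v mb +
        (1 + lam) * (3 * eps (numLevels T)) := by
  set f := roundedPolicy T p (numLevels T) with hf
  set ε := eps (numLevels T)
  have hε : 0 < ε := eps_pos _
  have hT' : (0 : ℝ) < 1 / T := by
    have : 0 < T := by omega
    positivity
  have hval : edgeVal f v = disc (p (disc v ε)) (1 / T) := by
    rw [← gridPt_gridFloor _ hv.2]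
    rfl
  have h1 := abs_le.1 ((hlip (disc v ε) v).trans_eq (abs_sub_comm _ _))
  rw [abs_of_nonneg (sub_nonneg.2 (disc_le hv.1 hε))] at h1
  have h2 := lt_disc_add v hε
  have h3 := disc_le (hp (disc v ε)).1 hT'
  have h4 := lt_disc_add (p (disc v ε)) hT'
  have h5 : 1 / (T : ℝ) ≤ ε := inv_le_eps hT le_rfl
  -- One `ε` pays for rounding `v` and one for rounding the bid to the `1/T`-lattice.
  have hlow : p v ≤ edgeVal f v + 2 * ε := by rw [hval]; linarith
  have hup : edgeVal f v + 2 * ε ≤ p v + 3 * ε := by rw [hval]; linarith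
  have hr := instReward_nonneg f v mb hlam
  have hpos : 0 ≤ (1 + lam) * (3 * ε) := by positivity
  unfold reward cost
  split_ifs with hw
  -- If the comparator has positive utility, `p v` lies below the cap `v / (1 + lam)`, so the
  -- thresholded bid is still at least `p v` and wins too.
  · rcases le_or_gt (v - (1 + lam) * p v) 0 with hneg | hge
    · linarith
    · have hb : p v ≤ thresholded f v lam := by
        refine le_min hlow ?_
        rw [le_div_iff₀ (by linarith)]
        linarith
      have hb' : thresholded f v lam ≤ p v + 3 * ε := (min_le_left _ _).trans hup
      rw [instReward, if_pos (hw.trans hb)]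
      nlinarith
  · linarith

omit hp hlip

/-! ### The regret bound -/

theorem sum_node_bounds_le (hT : 16 ≤ T) {ρ : ℝ} (hρ : 0 < ρ) (hρ1 : ρ ≤ 1) {L : ℕ → ℝ}
    (hL : ∀ m, L m ≤ 8 * 2 ^ m * Real.log T) :
    ∑ m ∈ range (numLevels T), (5 * L m + 3 * √(T * gap ρ m * L m)) ≤
      64 * (1 / ρ * √T * Real.log T ^ 2) := by
  have hl := one_le_log hT
  have hr : 1 ≤ 1 / ρ := (one_le_div hρ).2 hρ1
  have hs := Real.sqrt_nonneg (T : ℝ)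
  have hterm : ∀ m ∈ range (numLevels T), 5 * L m + 3 * √(T * gap ρ m * L m) ≤
      40 * Real.log T * 2 ^ m + 24 * (1 / ρ * √T * Real.log T) := by
    intro m _
    have hgap : gap ρ m = 4 * (1 + 1 / ρ) / 2 ^ m := by simp only [gap, eps, mul_one_div]
    -- The factors `2 ^ m` of `L m` and `2 ^ (-m)` of `gap ρ m` cancel. The bound is then loosened
    -- by `1 + 1/ρ ≤ 2 (1/ρ)²` and `log T ≤ log² T` to make it a perfect square.
    have hsq : √(T * gap ρ m * L m) ≤ 8 * (1 / ρ * √T * Real.log T) := by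
      refine Real.sqrt_le_iff.2 ⟨by positivity, ?_⟩
      have hgpos : 0 ≤ T * gap ρ m := by rw [hgap]; positivity
      calc T * gap ρ m * L m ≤ T * gap ρ m * (8 * 2 ^ m * Real.log T) := by
            gcongr
            exact hL m
        _ = 32 * (T * ((1 + 1 / ρ) * Real.log T)) := by rw [hgap]; field_simp; ring
        _ ≤ 32 * (T * (2 * (1 / ρ) ^ 2 * Real.log T ^ 2)) := by
            gcongr <;> nlinarith
        _ = (8 * (1 / ρ * √T * Real.log T)) ^ 2 := by
            rw [mul_pow, mul_pow, mul_pow, Real.sq_sqrt (Nat.cast_nonneg T)]; ring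
    linarith [hL m]
  refine (Finset.sum_le_sum hterm).trans ?_
  rw [Finset.sum_add_distrib, ← Finset.mul_sum, Finset.sum_const, Finset.card_range,
    nsmul_eq_mul]
  have hgeom : ∑ m ∈ range (numLevels T), (2 : ℝ) ^ m ≤ √T := by
    rw [geom_sum_eq (by norm_num)]
    linarith [two_pow_numLevels_le hT]
  have b1 : 40 * Real.log T * ∑ m ∈ range (numLevels T), (2 : ℝ) ^ m ≤
      40 * (1 / ρ * √T * Real.log T ^ 2) := by
    calc _ ≤ 40 * Real.log T * √T := by gcongr
      _ = 40 * (1 * √T * (Real.log T * 1)) := by ring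
      _ ≤ 40 * (1 / ρ * √T * (Real.log T * Real.log T)) := by gcongr
      _ = _ := by ring
  have b2 : numLevels T * (24 * (1 / ρ * √T * Real.log T)) ≤
      24 * (1 / ρ * √T * Real.log T ^ 2) := by
    calc _ ≤ Real.log T * (24 * (1 / ρ * √T * Real.log T)) := by
          gcongr
          exact numLevels_le_log hT
      _ = _ := by ring
  linarith

theorem sum_utility_sub_algReward_le (hT : 16 ≤ T) {ρ : ℝ} (hρ : 0 < ρ) (hρ1 : ρ ≤ 1)
    {ζ₀ : GridFun (numLevels T)} (hζ : ∀ i, 0 ≤ ζ₀ i)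
    {v lam : ℕ → ℝ} (mb : ℕ → ℝ) (hv : ∀ t, v t ∈ Set.Icc 0 1)
    (hlam : ∀ t ∈ Icc 1 T, lam t ∈ Set.Icc 0 (1 / ρ)) (hp : ∀ x, p x ∈ Set.Icc 0 1)
    (hlip : ∀ x y, |p x - p y| ≤ |x - y|) :
    ∑ t ∈ Icc 1 T, (reward (v t) (mb t) (p (v t)) - lam t * cost (mb t) (p (v t)) -
        algReward T (numLevels T) ζ₀ ρ v mb lam t) ≤
      76 * (1 / ρ * √T * Real.log T ^ 2) := by
  obtain ⟨k, hk⟩ := Nat.exists_eq_succ_of_ne_zero (numLevels_pos hT).ne'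
  have hl := one_le_log hT
  have hr : 1 ≤ 1 / ρ := (one_le_div hρ).2 hρ1
  let X : ℕ → Node → ℝ := fun t h => mixtureReward T (numLevels T) ζ₀
    (expWeights T (numLevels T) ζ₀ ρ (t + 1) (cumReward T (numLevels T) ζ₀ ρ v mb lam t)) h
    (lam (t + 1)) (v (t + 1)) (mb (t + 1))
  have hIcc : Icc 1 T = Ico (0 + 1) (T + 1) := by
    ext
    simp only [Finset.mem_Icc, Finset.mem_Ico]
    omega
  -- The sum over `m` telescopes from the root, which earns the algorithm's reward, to the leaf of
  -- the comparator's path; the factor `2 * (1 / ρ)` bounds `1 + lam`.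
  have hround : ∀ t ∈ range T,
      reward (v (t + 1)) (mb (t + 1)) (p (v (t + 1))) -
          lam (t + 1) * cost (mb (t + 1)) (p (v (t + 1))) -
          algReward T (numLevels T) ζ₀ ρ v mb lam (t + 1) ≤
        ∑ m ∈ range (numLevels T), (X t (roundedPath T p (m + 1)) - X t (roundedPath T p m)) +
          2 * (1 / ρ) * (3 * eps (numLevels T)) := by
    intro t ht
    have hlt := hlam (t + 1) (Finset.mem_Icc.2 (by have := Finset.mem_range.1 ht; omega))
    have h1 := utility_le_instReward hp hlip hT (mb (t + 1)) (hv (t + 1)) hlt.1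
    have h2 : X t (roundedPath T p (numLevels T)) =
        instReward (roundedPolicy T p (numLevels T)) (lam (t + 1)) (v (t + 1)) (mb (t + 1)) := by
      have hnode := isNode_roundedPath hp hlip hT (ζ₀ := ζ₀) (le_refl _)
      have hpath : roundedPath T p (numLevels T) = roundedPolicy T p (numLevels T) :: roundedPath T p k := by
        rw [hk]; rfl
      simp only [X]
      rw [hpath] at hnode ⊢
      exact mixtureReward_terminal _ hnode rfl _ _ _
    have h3 : (1 + lam (t + 1)) * (3 * eps (numLevels T)) ≤ 2 * (1 / ρ) * (3 * eps (numLevels T)) := by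
      have := eps_pos (numLevels T)
      gcongr
      linarith [hlt.2]
    have h4 : algReward T (numLevels T) ζ₀ ρ v mb lam (t + 1) = X t (roundedPath T p 0) := rfl
    rw [Finset.sum_range_sub fun m => X t (roundedPath T p m), h2, h4]
    linarith
  have hnode : ∀ m ∈ range (numLevels T),
      ∑ t ∈ range T, (X t (roundedPath T p (m + 1)) - X t (roundedPath T p m)) ≤
        5 * Real.log (#(edges T (numLevels T) ζ₀ (roundedPath T p m))) +
          3 * √(T * gap ρ m * Real.log (#(edges T (numLevels T) ζ₀ (roundedPath T p m)))) := by
    intro m hm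
    have hm' := Finset.mem_range.1 hm
    have := node_regret_le (by omega) (numLevels_pos hT) hζ hρ mb T hv hlam
      (isNode_roundedPath hp hlip hT hm'.le) (roundedPolicy_mem_edges hp hlip hT hm')
    rw [level_roundedPath] at this
    exact this
  rw [hIcc, ← Finset.sum_Ico_add', ← Finset.range_eq_Ico]
  refine (Finset.sum_le_sum hround).trans ?_
  rw [Finset.sum_add_distrib, Finset.sum_comm, Finset.sum_const, Finset.card_range, nsmul_eq_mul]
  have hbound := sum_node_bounds_le hT hρ hρ1
    (L := fun m => Real.log (#(edges T (numLevels T) ζ₀ (roundedPath T p m)))) fun m => by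
      have := log_card_edges_le (M := numLevels T) (ζ₀ := ζ₀) (by omega : 2 ≤ T) (roundedPath T p m)
      rwa [level_roundedPath] at this
  have hdisc : T * (2 * (1 / ρ) * (3 * eps (numLevels T))) ≤ 12 * (1 / ρ * √T * Real.log T ^ 2) := by
    calc _ = 6 * (1 / ρ) * (T * eps (numLevels T)) := by ring
      _ ≤ 6 * (1 / ρ) * (2 * √T) :=
          mul_le_mul_of_nonneg_left (mul_eps_numLevels_le hT) (by positivity)
      _ = 12 * (1 / ρ * √T * 1 ^ 2) := by ring
      _ ≤ 12 * (1 / ρ * √T * Real.log T ^ 2) := by gcongr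
  -- The total `76` is `64` from the node regrets plus `12` from the discretization.
  linarith [Finset.sum_le_sum hnode]

end FirstPrice

theorem mainTheorem5 :
    ∃ C : ℝ, ∀ T : ℕ, 16 ≤ T → ∀ ρ : ℝ, 0 < ρ → ρ ≤ 1 →
      ∀ V B : Set ℝ, V ⊆ Set.Icc 0 1 → B ⊆ Set.Icc 0 1 →
      ∀ ζ₀ : FirstPrice.GridFun (FirstPrice.numLevels T), (∀ i, 0 ≤ ζ₀ i) →
      ∀ (v : ℕ → V) (mb lam : ℕ → ℝ),
        (∀ t ∈ Finset.Icc 1 T, lam t ∈ Set.Icc 0 (1 / ρ)) →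
        FirstPrice.primalRegret T ζ₀ ρ V B v mb lam ≤
          ((C * (1 / ρ * √(T : ℝ) * Real.log T ^ 2) : ℝ) : EReal) := by
  refine ⟨76, fun T hT ρ hρ hρ1 V B hV hB ζ₀ hζ v mb lam hlam => ?_⟩
  refine iSup₂_le fun π hπ => EReal.coe_le_coe_iff.2 ?_
  obtain ⟨p, hp, hlip, hpπ⟩ := FirstPrice.exists_lipschitz_extension hB hπ
  simp only [← hpπ]
  exact FirstPrice.sum_utility_sub_algReward_le hT hρ hρ1 hζ mb (fun t => hV (v t).2) hlam hp hlip
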